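/- Let $p\ge 0$ and $[p]=\{1,\dots,p\}$. Consider a structural causal model with real features $X_1,\dots,X_p$: an acyclic directed graph $\mathcal G$ on $[p]$, measurable functions $f_j$, and mutually independent real noise variables $U_1,\dots,U_p$ such that $X_j=f_j(\mathrm{PA}_j;U_j)$ for all $j$, where $\mathrm{PA}_j$ are the features that are parents of $X_j$ in $\mathcal G$. Recursive substitution gives $X_j=F_j(U_1,\dots,U_p)$. Assume that, for every $j$ which has at least one parent, $F_j$ is monotone increasing (not necessarily strictly) in $u_j$ when the other $u_i$ are held fixed. Let $\hat Y=\mathcal N(X_1,\dots,X_p)$ with $\mathcal N:\mathbb R^p\to\mathbb R$ measurable and $0<\mathbb V(\hat Y)<\infty$. For $\mathbf V\in\{\mathbf U,\mathbf X\}$, $I\subseteq[p]$ and $\mathbf V_I=(V_i)_{i\in I}$ put $$\phi(\hat Y|\mathbf V_I)=\frac{\mathbb V(\mathbb E(\hat Y|\mathbf V_I))}{\mathbb V(\hat Y)},\qquad \mathcal S_I=\frac{\mathbb V(f_I(\mathbf X_I))}{\mathbb V(\hat Y)},$$ where the random variables $f_I(\mathbf X_I)$ are defined recursively by $f_I(\mathbf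 X_I)=\mathbb E(\hat Y|\mathbf X_I)-\sum_{T\subsetneq I}f_T(\mathbf X_T)$; the numbers $\mathcal S_I$ are the Sobol' indices. For $j\in[p]$ and $I\subseteq[p]\setminus\{j\}$ put $ICC_\phi(X_j\to\hat Y|I)=\phi(\hat Y|\mathbf U_{I\cup\{j\}})-\phi(\hat Y|\mathbf U_I)$ and $$ICC^{\mathrm{Sh}}_\phi(X_j\to\hat Y)=\sum_{T\subseteq[p]\setminus\{j\}}\frac{1}{p\binom{p-1}{|T|}}\,ICC_\phi(X_j\to\hat Y|T),\qquad ICC^{\mathrm{To}}_\phi(X_j\to\hat Y)=\frac1{|\mathcal C(\mathcal G)|}\sum_{\pi\in\mathcal C(\mathcal G)}ICC_\phi(X_j\to\hat Y|\{k:\pi(k)<\pi(j)\}),$$ where $\mathcal C(\mathcal G)$ is the set of topological orderings of $\mathcal G$, that is, of the permutations $\pi$ of $[p]$ with $\pi(i)<\pi(j)$ for every edge $i\to j$. Assume that the features $X_1,\dots,X_p$ are mutually independent. Then for all $I\subseteq[p]$ and all $j\in[p]$ $$\phi(\hat Y|\mathbf U_I)=\phi(\hat Y|\mathbf X_I)=\sum_{T\subseteq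 I}\mathcal S_T,\qquad ICC^{\mathrm{Sh}}_\phi(X_j\to\hat Y)=\sum_{T\subseteq[p],\,j\in T}\frac{\mathcal S_T}{|T|}.$$ If moreover every edge of $\mathcal G$ is a genuine dependence (for an edge $i\to j$, $X_j$ is not almost surely equal to a measurable function of $U_j$ and of the parents of $X_j$ other than $X_i$), then for all $j\in[p]$ $$ICC^{\mathrm{To}}_\phi(X_j\to\hat Y)=ICC^{\mathrm{Sh}}_\phi(X_j\to\hat Y)=\sum_{T\subseteq[p],\,j\in T}\frac{\mathcal S_T}{|T|}.$$ -/

import Mathlib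

open MeasureTheory ProbabilityTheory

noncomputable section

/-- A structural causal model on the real features `X_1, …, X_p` (indexed by `Fin p`): an acyclic
graph (`Adj i j` is the arrow `X_i → X_j`) and, for every `j`, a measurable mechanism
`X_j = f_j (PA_j, U_j)` whose arguments are the parents of `j` and the noise of `j`. -/
structure SCM (p : ℕ) where
  Adj : Fin p → Fin p → Prop
  acyclic : ∀ i, ¬ Relation.TransGen Adj i i
  f : (j : Fin p) → ({i : Fin p // Adj i j} → ℝ) → ℝ → ℝ
  measurable_f : ∀ j, Measurable (Function.uncurry (f j))

namespace SCM

variable {p : ℕ}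

theorem wf (S : SCM p) : WellFounded S.Adj := by
  have h1 : IsTrans (Fin p) (Relation.TransGen S.Adj) := ⟨fun _ _ _ => Relation.TransGen.trans⟩
  have h2 : Std.Irrefl (Relation.TransGen S.Adj) := ⟨S.acyclic⟩
  exact Subrelation.wf (fun h => Relation.TransGen.single h)
    (Finite.wellFounded_of_trans_of_irrefl (Relation.TransGen S.Adj))

/-- The reduced form `F = (F_1, …, F_p)`, obtained by recursive substitution of the structural
equations into one another: it expresses every feature through the noise alone. -/
def F (S : SCM p) (u : Fin p → ℝ) : Fin p → ℝ :=
  S.wf.fix (C := fun _ => ℝ) fun j rec => S.f j (fun i => rec i.1 i.2) (u j)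

theorem F_eq (S : SCM p) (u : Fin p → ℝ) (j : Fin p) :
    S.F u j = S.f j (fun i => S.F u i.1) (u j) :=
  S.wf.fix_eq (C := fun _ => ℝ) (fun j rec => S.f j (fun i => rec i.1 i.2) (u j)) j

/-- The features `X_j = F_j (U_1, …, U_p)` as random variables. -/
def X {Ω : Type*} (S : SCM p) (U : Fin p → Ω → ℝ) (j : Fin p) (ω : Ω) : ℝ :=
  S.F (fun i => U i ω) j

/-- The reduced form is monotone increasing: for each `j` that has at least one parent, `F_j` is
nondecreasing in its own noise variable `u_j` when the other noise variables are held fixed.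
(Nothing is asked at a feature without parents, where `F_j` is a function of `u_j` alone.) -/
def IsMonotone (S : SCM p) : Prop :=
  ∀ j, (∃ i, S.Adj i j) → ∀ u : Fin p → ℝ,
    Monotone fun t : ℝ => S.F (Function.update u j t) j

/-- Every arrow `i → j` of the graph is a genuine dependence: `X_j` is not almost surely
a function of its noise `U_j` and of its other parents. -/
def IsMinimal {Ω : Type*} [MeasurableSpace Ω] (S : SCM p) (μ : Measure Ω)
    (U : Fin p → Ω → ℝ) : Prop :=
  ∀ i j, S.Adj i j →
    ¬ ∃ g : ({k : Fin p // S.Adj k j ∧ k ≠ i} → ℝ) → ℝ → ℝ, Measurable (Function.uncurry g) ∧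
      ∀ᵐ ω ∂μ, S.X U j ω = g (fun k => S.X U k.1 ω) (U j ω)

open Classical in
/-- The set `C(G)` of topological orderings: `π i` is the position of the node `i`. -/
def topologicalOrderings (S : SCM p) : Finset (Equiv.Perm (Fin p)) :=
  Finset.univ.filter fun π => ∀ i j, S.Adj i j → π i < π j

end SCM

section Uncertainty

variable {Ω : Type*} [MeasurableSpace Ω] {p : ℕ}

/-- The `σ`-algebra generated by the subfamily `V_I = (V_i)_{i ∈ I}`. -/
abbrev sigmaOf (V : Fin p → Ω → ℝ) (I : Finset (Fin p)) : MeasurableSpace Ω :=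
  MeasurableSpace.comap (fun ω (i : I) => V i.1 ω) inferInstance

/-- `φ(Y | V_I) = Var(E(Y | V_I)) / Var(Y)`. -/
def phi (μ : Measure Ω) (V : Fin p → Ω → ℝ) (Y : Ω → ℝ) (I : Finset (Fin p)) : ℝ :=
  Var[μ[Y | sigmaOf V I]; μ] / Var[Y; μ]

/-- The ANOVA components `f_T(X_T) = E(Y | X_T) - ∑_{T' ⊂ T} f_{T'}(X_{T'})`, as random
variables. -/
def anova (μ : Measure Ω) (X : Fin p → Ω → ℝ) (Y : Ω → ℝ) (T : Finset (Fin p)) : Ω → ℝ :=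
  fun ω => (μ[Y | sigmaOf X T]) ω - ∑ T' ∈ T.ssubsets.attach, anova μ X Y T'.1 ω
termination_by T.card
decreasing_by exact Finset.card_lt_card (Finset.mem_ssubsets.1 T'.2)

theorem anova_eq (μ : Measure Ω) (X : Fin p → Ω → ℝ) (Y : Ω → ℝ) (T : Finset (Fin p)) (ω : Ω) :
    anova μ X Y T ω = (μ[Y | sigmaOf X T]) ω - ∑ T' ∈ T.ssubsets, anova μ X Y T' ω := by
  conv_lhs => unfold anova
  rw [Finset.sum_attach T.ssubsets fun T' => anova μ X Y T' ω]

/-- The Sobol' index `S_T = Var(f_T(X_T)) / Var(Y)`. -/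
def sobol (μ : Measure Ω) (X : Fin p → Ω → ℝ) (Y : Ω → ℝ) (T : Finset (Fin p)) : ℝ :=
  Var[anova μ X Y T; μ] / Var[Y; μ]

end Uncertainty

section Contributions

variable {p : ℕ}

/-- `ICC(X_j → Y | I) = φ(Y | U_{I + j}) - φ(Y | U_I)`, with `ψ I` standing for `φ(Y | U_I)`. -/
def ICC (ψ : Finset (Fin p) → ℝ) (j : Fin p) (I : Finset (Fin p)) : ℝ :=
  ψ (insert j I) - ψ I

/-- The Shapley-based contribution. -/
def ICCSh (ψ : Finset (Fin p) → ℝ) (j : Fin p) : ℝ :=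
  ∑ T ∈ (Finset.univ.erase j).powerset,
    1 / ((p : ℝ) * ((p - 1).choose T.card : ℝ)) * ICC ψ j T

/-- The indices that occur before `j` in the ordering `π`. -/
def before (π : Equiv.Perm (Fin p)) (j : Fin p) : Finset (Fin p) :=
  Finset.univ.filter fun k => π k < π j

/-- The contribution averaged over the topological orderings of the causal graph. -/
def ICCTo (S : SCM p) (ψ : Finset (Fin p) → ℝ) (j : Fin p) : ℝ :=
  1 / (S.topologicalOrderings.card : ℝ) * ∑ π ∈ S.topologicalOrderings, ICC ψ j (before π j)

end Contributions

end

/-! The crux is that each feature is almost surely a function of its own noise. Let `Z` be the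
parents of `X_j`. Acyclicity makes `Z` independent of `U_j`, and independence of the features makes
it independent of `X_j = f_j(Z, U_j)`. So for almost every `z` the variable `f_j(z, U_j)` has the
law of `X_j`. Nondecreasing functions of `U_j` with equal laws agree almost surely, so `z` drops out
(`exists_X_ae_eq_comp`). Without monotonicity this fails: for independent fair signs, `Z * W` is
independent of `Z` but is not a function of `W`.

Conditioning on `U_I` or on `X_I` then integrates out the same independent remainder, so the two
`phi` agree. For independent features the conditional expectations commute, the ANOVA components are
uncorrelated, and `phi` is the subset sum of the Sobol' indices. Averaging its increments with
Shapley weights, or over all orderings, splits each index equally among the members of its set.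
Finally, a genuine edge would contradict the first step, so minimality leaves no edges and every
ordering is topological. -/

open MeasureTheory ProbabilityTheory

/-! ### Monotone functions with equal laws -/

/-- Two monotone functions whose sublevel sets at rational levels have the same measure
are almost everywhere equal. -/
theorem Monotone.ae_eq_of_measure_le_eq {ν : Measure ℝ} [IsFiniteMeasure ν] {g h : ℝ → ℝ}
    (hg : Monotone g) (hh : Monotone h)
    (heq : ∀ q : ℚ, ν {t | g t ≤ q} = ν {t | h t ≤ q}) : g =ᵐ[ν] h := by
  have lower : ∀ {k : ℝ → ℝ}, Monotone k → ∀ q : ℚ, IsLowerSet {t | k t ≤ q} :=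
    fun hk q a b hab ha => (hk hab).trans ha
  have key : ∀ q : ℚ, {t | g t ≤ q} =ᵐ[ν] {t | h t ≤ q} := by
    intro q
    have mg := (hg.measurable measurableSet_Iic : MeasurableSet (g ⁻¹' Set.Iic (q : ℝ)))
    have mh := (hh.measurable measurableSet_Iic : MeasurableSet (h ⁻¹' Set.Iic (q : ℝ)))
    -- Lower sets of a line are nested, and nested sets of equal finite measure differ by a null
    -- set.
    rcases (lower hg q).total (lower hh q) with hs | hs
    · exact ae_eq_of_subset_of_measure_ge hs (heq q).ge mg.nullMeasurableSet (measure_ne_top _ _)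
    · exact (ae_eq_of_subset_of_measure_ge hs (heq q).le mh.nullMeasurableSet
        (measure_ne_top _ _)).symm
  have hall : ∀ᵐ t ∂ν, ∀ q : ℚ, (g t ≤ q ↔ h t ≤ q) := by
    rw [ae_all_iff]
    intro q
    filter_upwards [key q] with t ht
    exact iff_of_eq ht
  filter_upwards [hall] with t ht
  apply le_antisymm
  · exact le_of_forall_lt_rat_imp_le fun q hq => (ht q).2 hq.le
  · exact le_of_forall_lt_rat_imp_le fun q hq => (ht q).1 hq.le

/-- If `Z` and `W` are independent, `f(Z, W)` is independent of `Z` and `f(Z ω, ·)` is monotone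
for every `ω`, then `f(Z, W)` is almost surely a function of `W`. -/
theorem exists_ae_eq_comp_of_indepFun_of_monotone {Ω α : Type*} [MeasurableSpace Ω]
    [MeasurableSpace α] {μ : Measure Ω} [IsProbabilityMeasure μ] {Z : Ω → α} {W : Ω → ℝ}
    (hZ : Measurable Z) (hW : Measurable W) (hZW : IndepFun Z W μ) {f : α → ℝ → ℝ}
    (hf : Measurable (Function.uncurry f)) (hind : IndepFun Z (fun ω => f (Z ω) (W ω)) μ)
    (hmono : ∀ ω, Monotone (f (Z ω))) :
    ∃ g : ℝ → ℝ, Measurable g ∧ ∀ᵐ ω ∂μ, f (Z ω) (W ω) = g (W ω) := by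
  have : IsProbabilityMeasure (μ.map Z) := Measure.isProbabilityMeasure_map hZ.aemeasurable
  have : IsProbabilityMeasure (μ.map W) := Measure.isProbabilityMeasure_map hW.aemeasurable
  have hprod := (indepFun_iff_map_prod_eq_prod_map_map hZ.aemeasurable hW.aemeasurable).1 hZW
  have hsub : ∀ q : ℚ, MeasurableSet {x : α × ℝ | f x.1 x.2 ≤ q} := fun q =>
    hf measurableSet_Iic
  -- Both sides integrate over `s` to the probability that `Z ∈ s` and `f(Z, W) ≤ q`: the left by
  -- the product law of `(Z, W)`, the right by `hind`.
  have hconst : ∀ q : ℚ, ∀ᵐ z ∂μ.map Z,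
      μ.map W {t | f z t ≤ q} = μ {ω | f (Z ω) (W ω) ≤ q} := by
    intro q
    refine ae_eq_of_forall_setLIntegral_eq_of_sigmaFinite
      (measurable_measure_prodMk_left (hsub q)) measurable_const fun s hs _ => ?_
    rw [setLIntegral_const, ← lintegral_indicator hs]
    change ∫⁻ z, s.indicator (fun z => μ.map W (Prod.mk z ⁻¹' {x : α × ℝ | f x.1 x.2 ≤ q})) z
      ∂μ.map Z = _
    have h1 : (μ.map Z).prod (μ.map W) ((s ×ˢ Set.univ) ∩ {x : α × ℝ | f x.1 x.2 ≤ q}) =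
        ∫⁻ z, s.indicator (fun z => μ.map W (Prod.mk z ⁻¹' {x : α × ℝ | f x.1 x.2 ≤ q})) z
          ∂μ.map Z := by
      rw [Measure.prod_apply ((hs.prod MeasurableSet.univ).inter (hsub q))]
      refine lintegral_congr fun z => ?_
      by_cases hz : z ∈ s <;> simp [hz]
    rw [← h1, ← hprod, Measure.map_apply (hZ.prodMk hW)
      ((hs.prod MeasurableSet.univ).inter (hsub q)), Measure.map_apply hZ hs]
    have h2 := hind.measure_inter_preimage_eq_mul s (Set.Iic (q : ℝ)) hs measurableSet_Iic
    rw [mul_comm]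
    refine Eq.trans (congrArg μ ?_) h2
    ext ω
    simp
  have hall : ∀ᵐ ω ∂μ, ∀ q : ℚ,
      μ.map W {t | f (Z ω) t ≤ q} = μ {ω | f (Z ω) (W ω) ≤ q} := by
    rw [ae_all_iff]
    exact fun q => ae_of_ae_map hZ.aemeasurable (hconst q)
  -- Any typical `ω₀` serves: almost every section of `f` agrees with the one at `Z ω₀`.
  obtain ⟨ω₀, hω₀⟩ := hall.exists
  refine ⟨f (Z ω₀), hf.comp measurable_prodMk_left, ?_⟩
  have hset : MeasurableSet {x : α × ℝ | f x.1 x.2 = f (Z ω₀) x.2} :=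
    measurableSet_eq_fun hf (hf.comp (measurable_const.prodMk measurable_snd))
  have hset' : MeasurableSet {z | ∀ᵐ t ∂μ.map W, f z t = f (Z ω₀) t} :=
    measurable_measure_prodMk_left hset.compl (measurableSet_singleton 0)
  have hae : ∀ᵐ x ∂(μ.map Z).prod (μ.map W), f x.1 x.2 = f (Z ω₀) x.2 := by
    rw [Measure.ae_prod_iff_ae_ae hset, ae_map_iff hZ.aemeasurable hset']
    filter_upwards [hall] with ω hω
    exact (hmono ω).ae_eq_of_measure_le_eq (hmono ω₀) fun q => (hω q).trans (hω₀ q).symm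
  rw [← hprod] at hae
  exact ae_of_ae_map (hZ.prodMk hW).aemeasurable hae

/-! ### Features as functions of their own noise -/

namespace SCM

variable {p : ℕ}

theorem measurable_F (S : SCM p) (j : Fin p) : Measurable fun u => S.F u j := by
  induction j using S.wf.induction with
  | _ j ih =>
    simp_rw [S.F_eq _ j]
    exact (S.measurable_f j).comp
      ((measurable_pi_lambda _ fun i => ih i.1 i.2).prodMk (measurable_pi_apply j))

theorem measurable_X {Ω : Type*} [MeasurableSpace Ω] (S : SCM p) {U : Fin p → Ω → ℝ}
    (hU : ∀ i, Measurable (U i)) (j : Fin p) : Measurable (S.X U j) :=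
  (S.measurable_F j).comp (measurable_pi_lambda _ hU)

theorem F_update_of_not_reachable (S : SCM p) (u : Fin p → ℝ) (j : Fin p) (t : ℝ) (i : Fin p)
    (h : ¬ Relation.ReflTransGen S.Adj j i) : S.F (Function.update u j t) i = S.F u i := by
  induction i using S.wf.induction with
  | _ i ih =>
    have hij : i ≠ j := fun e => h (e ▸ Relation.ReflTransGen.refl)
    rw [S.F_eq, S.F_eq u, Function.update_of_ne hij]
    congr 1
    ext k
    exact ih k.1 k.2 fun hk => h (hk.tail k.2)

theorem F_update_of_adj (S : SCM p) (u : Fin p → ℝ) {i j : Fin p} (t : ℝ) (h : S.Adj i j) :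
    S.F (Function.update u j t) i = S.F u i :=
  S.F_update_of_not_reachable u j t i fun hji => S.acyclic i (Relation.TransGen.head' h hji)

/-- Independence of the features makes each of them a function of its own noise. -/
theorem exists_X_ae_eq_comp {Ω : Type*} [MeasurableSpace Ω] {μ : Measure Ω}
    [IsProbabilityMeasure μ] (S : SCM p) (hmono : S.IsMonotone) {U : Fin p → Ω → ℝ}
    (hU : ∀ i, Measurable (U i)) (hUindep : iIndepFun U μ) (hXindep : iIndepFun (S.X U) μ)
    (j : Fin p) : ∃ g : ℝ → ℝ, Measurable g ∧ S.X U j =ᵐ[μ] fun ω => g (U j ω) := by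
  classical
  have hX_eq : ∀ ω, S.X U j ω = S.f j (fun i => S.X U i.1 ω) (U j ω) := fun ω => S.F_eq _ j
  by_cases hpa : ∃ i, S.Adj i j
  swap
  -- Without parents the first argument of `f j` ranges over a one-point space, so `0` is its only
  -- value.
  · refine ⟨S.f j 0, (S.measurable_f j).comp measurable_prodMk_left, .of_forall fun ω => ?_⟩
    rw [hX_eq]
    congr 1
    ext i
    exact absurd ⟨i.1, i.2⟩ hpa
  let Z : Ω → ({i : Fin p // S.Adj i j} → ℝ) := fun ω i => S.X U i.1 ω
  have hZ : Measurable Z := measurable_pi_lambda _ fun i => S.measurable_X hU i.1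
  have hdisj : Disjoint ({j}ᶜ : Finset (Fin p)) {j} := disjoint_compl_left
  have hev : Measurable fun y : (({j} : Finset (Fin p)) → ℝ) => y ⟨j, by simp⟩ :=
    measurable_pi_apply _
  have hZU : IndepFun Z (U j) μ := by
    have h := hUindep.indepFun_finset _ _ hdisj hU
    -- The noise of `j` is replaced by `0`, which is harmless because parents of `j` do not depend
    -- on it.
    let ψ : (({j}ᶜ : Finset (Fin p)) → ℝ) → ({i : Fin p // S.Adj i j} → ℝ) := fun y i =>
      S.F (Function.updateFinset 0 {j}ᶜ y) i.1
    have hψ : Measurable ψ :=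
      measurable_pi_lambda _ fun i => (S.measurable_F i.1).comp measurable_updateFinset
    refine (h.comp hψ hev).congr (.of_forall fun ω => funext fun i => ?_) (.of_forall fun _ => rfl)
    symm
    change S.F (fun k => U k ω) i.1 = S.F (Function.updateFinset 0 {j}ᶜ fun i => U i ω) i.1
    rw [← S.F_update_of_adj (fun k => U k ω) 0 i.2]
    congr 1
    ext k
    by_cases hk : k = j
    · subst hk; simp [Function.updateFinset]
    · simp [Function.updateFinset, hk]
  have hZX : IndepFun Z (fun ω => S.f j (Z ω) (U j ω)) μ := by
    have h := hXindep.indepFun_finset _ _ hdisj (S.measurable_X hU)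
    have hne : ∀ i : {i : Fin p // S.Adj i j}, i.1 ∈ ({j}ᶜ : Finset (Fin p)) := by
      intro i
      simp only [Finset.mem_compl, Finset.mem_singleton]
      exact fun e => S.acyclic j (.single (by simpa [e] using i.2))
    let ψ : (({j}ᶜ : Finset (Fin p)) → ℝ) → ({i : Fin p // S.Adj i j} → ℝ) := fun y i =>
      y ⟨i.1, hne i⟩
    have hψ : Measurable ψ := measurable_pi_lambda _ fun i => measurable_pi_apply _
    exact (h.comp hψ hev).congr (.of_forall fun _ => rfl) (.of_forall hX_eq)
  -- Moving `u_j` leaves the parents fixed, so monotonicity of `F_j` passes to `f_j` at attained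
  -- parent values.
  have hm : ∀ ω, Monotone (S.f j (Z ω)) := by
    intro ω
    have h := hmono j hpa fun k => U k ω
    convert h using 2 with t
    rw [S.F_eq, Function.update_self]
    congr 1
    ext i
    exact (S.F_update_of_adj _ t i.2).symm
  obtain ⟨g, hg, hae⟩ := exists_ae_eq_comp_of_indepFun_of_monotone hZ (hU j) hZU
    (S.measurable_f j) hZX hm
  refine ⟨g, hg, ?_⟩
  filter_upwards [hae] with ω hω
  rw [hX_eq]
  exact hω

theorem IsMinimal.not_adj {Ω : Type*} [MeasurableSpace Ω] {μ : Measure Ω}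
    {S : SCM p} {U : Fin p → Ω → ℝ} (hmin : S.IsMinimal μ U)
    (h : ∀ j, ∃ g : ℝ → ℝ, Measurable g ∧ S.X U j =ᵐ[μ] fun ω => g (U j ω)) (i j : Fin p) :
    ¬ S.Adj i j := fun hij => by
  obtain ⟨g, hg, hae⟩ := h j
  exact hmin i j hij ⟨fun _ => g, hg.comp measurable_snd, hae⟩

end SCM

/-! ### Conditioning on independent coordinates -/

section CondExp

variable {Ω : Type*} [mΩ : MeasurableSpace Ω] {μ : Measure Ω} {p : ℕ}

theorem measurable_restrict_family {V : Fin p → Ω → ℝ} (hV : ∀ i, Measurable (V i))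
    (I : Finset (Fin p)) : Measurable fun ω (i : I) => V i.1 ω :=
  measurable_pi_lambda _ fun i => hV i.1

theorem sigmaOf_le {V : Fin p → Ω → ℝ} (hV : ∀ i, Measurable (V i)) (I : Finset (Fin p)) :
    sigmaOf V I ≤ mΩ :=
  (measurable_restrict_family hV I).comap_le

theorem sigmaOf_mono {Ω : Type*} (V : Fin p → Ω → ℝ) {I J : Finset (Fin p)} (h : I ⊆ J) :
    sigmaOf V I ≤ sigmaOf V J := by
  have hm : Measurable fun (x : J → ℝ) (i : I) => x ⟨i.1, h i.2⟩ :=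
    measurable_pi_lambda _ fun i => measurable_pi_apply _
  rw [sigmaOf, sigmaOf]
  have := MeasurableSpace.comap_mono (g := fun ω (i : J) => V i.1 ω) hm.comap_le
  rwa [MeasurableSpace.comap_comp] at this

theorem memLp_anova (X : Fin p → Ω → ℝ) {Y : Ω → ℝ} (hY : MemLp Y 2 μ) (T : Finset (Fin p)) :
    MemLp (anova μ X Y T) 2 μ := by
  induction T using Finset.strongInduction with
  | _ T ih =>
    have h : anova μ X Y T = fun ω =>
        (μ[Y | sigmaOf X T]) ω - ∑ T' ∈ T.ssubsets, anova μ X Y T' ω :=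
      funext (anova_eq μ X Y T)
    rw [h]
    exact (hY.condExp one_le_two).sub
      (memLp_finsetSum _ fun T' hT' => ih T' (Finset.mem_ssubsets.1 hT'))

theorem condExp_eq_sum_anova (X : Fin p → Ω → ℝ) (Y : Ω → ℝ) (T : Finset (Fin p)) :
    μ[Y | sigmaOf X T] = fun ω => ∑ R ∈ T.powerset, anova μ X Y R ω := by
  ext ω
  rw [← Finset.insert_erase (Finset.mem_powerset_self T),
    Finset.sum_insert (Finset.notMem_erase _ _), anova_eq]
  simp [Finset.ssubsets]

variable [IsProbabilityMeasure μ]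

/-- Conditioning a function of two independent variables on the first one integrates
the second one out. -/
theorem ProbabilityTheory.IndepFun.condExp_ae_eq_integral {α γ : Type*} [mα : MeasurableSpace α]
    [MeasurableSpace γ] [StandardBorelSpace γ] [Nonempty γ] {A : Ω → α} {C : Ω → γ}
    (hAC : IndepFun A C μ) (hA : Measurable A) (hC : Measurable C) {H : α × γ → ℝ}
    (hH : Measurable H) (hint : Integrable (fun ω => H (A ω, C ω)) μ) :
    μ[fun ω => H (A ω, C ω) | mα.comap A] =ᵐ[μ] fun ω => ∫ c, H (A ω, c) ∂μ.map C := by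
  have : IsProbabilityMeasure (μ.map C) := Measure.isProbabilityMeasure_map hC.aemeasurable
  have h1 := condExp_prod_ae_eq_integral_condDistrib hA hC.aemeasurable hH.stronglyMeasurable hint
  have h2 : condDistrib C A μ =ᵐ[μ.map A] Kernel.const α (μ.map C) := by
    apply condDistrib_ae_eq_of_measure_eq_compProd _ hC.aemeasurable
    rw [Measure.compProd_const]
    exact (indepFun_iff_map_prod_eq_prod_map_map hA.aemeasurable hC.aemeasurable).1 hAC
  filter_upwards [h1, ae_of_ae_map hA.aemeasurable h2] with ω h1 h2
  rw [h1, h2, Kernel.const_apply]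

theorem integral_condExp_mul {m : MeasurableSpace Ω} (hm : m ≤ mΩ) {a b : Ω → ℝ}
    (ha : MemLp a 2 μ) (hb : MemLp b 2 μ) (hbm : StronglyMeasurable[m] b) :
    ∫ ω, a ω * b ω ∂μ = ∫ ω, (μ[a | m]) ω * b ω ∂μ := by
  have h := condExp_mul_of_stronglyMeasurable_right hbm (ha.integrable_mul hb)
    (ha.integrable one_le_two)
  rw [← integral_condExp hm (f := fun ω => a ω * b ω)]
  exact integral_congr_ae h

theorem condExp_sigmaOf_ae_eq_integral {V : Fin p → Ω → ℝ} (hV : ∀ i, Measurable (V i))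
    (hind : iIndepFun V μ) {h : (Fin p → ℝ) → ℝ} (hh : Measurable h)
    (hint : Integrable (fun ω => h fun i => V i ω) μ) (I : Finset (Fin p)) :
    μ[fun ω => h fun i => V i ω | sigmaOf V I] =ᵐ[μ] fun ω =>
      ∫ c, h (Function.updateFinset (fun i => V i ω) Iᶜ c)
        ∂μ.map fun ω (i : (Iᶜ : Finset (Fin p))) => V i.1 ω := by
  have hAC := hind.indepFun_finset I Iᶜ disjoint_compl_right hV
  -- The filler `0` is never read: every coordinate lies in `I` or in `Iᶜ`.
  let H : (I → ℝ) × ((Iᶜ : Finset (Fin p)) → ℝ) → ℝ := fun x =>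
    h (Function.updateFinset (Function.updateFinset 0 I x.1) Iᶜ x.2)
  have hH : Measurable H := hh.comp (measurable_updateFinset'.comp
    ((measurable_updateFinset.comp measurable_fst).prodMk measurable_snd))
  have e1 : ∀ ω c, h (Function.updateFinset (fun i => V i ω) Iᶜ c) =
      H (fun i => V i.1 ω, c) := by
    intro ω c
    congr 1
    ext i
    by_cases hi : i ∈ I <;> simp [Function.updateFinset, hi]
  have e2 : ∀ ω, h (fun i => V i ω) = H (fun i => V i.1 ω, fun i => V i.1 ω) := by
    intro ω
    rw [← e1]
    congr 1
    ext i
    simp [Function.updateFinset]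
  simp_rw [e1]
  simp_rw [e2] at hint ⊢
  exact hAC.condExp_ae_eq_integral (measurable_restrict_family hV I)
    (measurable_restrict_family hV Iᶜ) hH hint

/-- If each `X i` is almost surely a function of `U i` and the `U i` are independent, then
conditioning a function of `X` on `U_I` or on `X_I` gives the same. -/
theorem condExp_sigmaOf_ae_eq_of_ae_eq_comp {U X : Fin p → Ω → ℝ} (hU : ∀ i, Measurable (U i))
    (hX : ∀ i, Measurable (X i)) (hUind : iIndepFun U μ) (hXind : iIndepFun X μ)
    {g : Fin p → ℝ → ℝ} (hg : ∀ i, Measurable (g i))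
    (hXU : ∀ i, X i =ᵐ[μ] fun ω => g i (U i ω)) {h : (Fin p → ℝ) → ℝ} (hh : Measurable h)
    (hint : Integrable (fun ω => h fun i => X i ω) μ) (I : Finset (Fin p)) :
    μ[fun ω => h fun i => X i ω | sigmaOf U I] =ᵐ[μ]
      μ[fun ω => h fun i => X i ω | sigmaOf X I] := by
  have hall : ∀ᵐ ω ∂μ, ∀ i, X i ω = g i (U i ω) := ae_all_iff.2 hXU
  have hY : (fun ω => h fun i => X i ω) =ᵐ[μ] fun ω => h fun i => g i (U i ω) := by
    filter_upwards [hall] with ω hω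
    simp_rw [hω]
  have hgm : Measurable fun (u : Fin p → ℝ) i => g i (u i) :=
    measurable_pi_lambda _ fun i => (hg i).comp (measurable_pi_apply i)
  have hgm' : Measurable fun (u : (Iᶜ : Finset (Fin p)) → ℝ) i => g i.1 (u i) :=
    measurable_pi_lambda _ fun i => (hg i.1).comp (measurable_pi_apply i)
  have h1 := condExp_sigmaOf_ae_eq_integral hU hUind (hh.comp hgm) (hint.congr hY) I
  have h2 := condExp_sigmaOf_ae_eq_integral hX hXind hh hint I
  have hmap : (μ.map fun ω (i : (Iᶜ : Finset (Fin p))) => X i.1 ω) =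
      (μ.map fun ω (i : (Iᶜ : Finset (Fin p))) => U i.1 ω).map fun u i => g i.1 (u i) := by
    rw [Measure.map_map hgm' (measurable_restrict_family hU Iᶜ)]
    refine Measure.map_congr ?_
    filter_upwards [hall] with ω hω
    ext i
    exact hω i.1
  refine (condExp_congr_ae hY).trans ?_
  filter_upwards [h1, h2, hall] with ω h1 h2 hω
  refine h1.trans (Eq.trans ?_ h2.symm)
  rw [hmap, integral_map hgm'.aemeasurable (f := fun c =>
    h (Function.updateFinset (fun i => X i ω) Iᶜ c))
    (hh.comp measurable_updateFinset).aestronglyMeasurable]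
  refine integral_congr_ae (.of_forall fun c => ?_)
  change h _ = h _
  congr 1
  ext i
  by_cases hi : i ∈ I <;> simp [Function.updateFinset, hi, hω]

/-- The projections onto the `σ`-algebras of subfamilies of independent variables commute. -/
theorem condExp_condExp_sigmaOf {X : Fin p → Ω → ℝ} (hX : ∀ i, Measurable (X i))
    (hXind : iIndepFun X μ) (Y : Ω → ℝ) (I J : Finset (Fin p)) :
    μ[μ[Y | sigmaOf X I] | sigmaOf X J] =ᵐ[μ] μ[Y | sigmaOf X (I ∩ J)] := by
  -- Doob–Dynkin: the conditional expectation is a measurable function of `X_I`.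
  obtain ⟨h, hh, hhe⟩ := (stronglyMeasurable_condExp (m := sigmaOf X I)
    (μ := μ) (f := Y)).measurable.exists_eq_measurable_comp
  let r : (Fin p → ℝ) → (I → ℝ) := fun x i => x i.1
  have hr : Measurable r := measurable_pi_lambda _ fun i => measurable_pi_apply _
  have hE : μ[Y | sigmaOf X I] = fun ω => (h ∘ r) fun i => X i ω := hhe
  have hint : Integrable (fun ω => (h ∘ r) fun i => X i ω) μ := hE ▸ integrable_condExp
  have h1 := condExp_sigmaOf_ae_eq_integral hX hXind (hh.comp hr) hint J
  let ν := μ.map fun ω (i : (Jᶜ : Finset (Fin p))) => X i.1 ω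
  have : IsProbabilityMeasure ν :=
    Measure.isProbabilityMeasure_map (measurable_restrict_family hX Jᶜ).aemeasurable
  -- `h ∘ r` reads only coordinates in `I`; those outside `J` are integrated out, so only `I ∩ J`
  -- remains and the filler `0` has no effect.
  let K : ((I ∩ J : Finset (Fin p)) → ℝ) → ℝ := fun a => ∫ c,
    (h ∘ r) (Function.updateFinset (Function.updateFinset 0 (I ∩ J) a) Jᶜ c) ∂ν
  have hK : StronglyMeasurable K := by
    refine StronglyMeasurable.integral_prod_right (f := fun a c =>
      (h ∘ r) (Function.updateFinset (Function.updateFinset 0 (I ∩ J) a) Jᶜ c)) ?_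
    exact ((hh.comp hr).comp (measurable_updateFinset'.comp
      ((measurable_updateFinset.comp measurable_fst).prodMk measurable_snd))).stronglyMeasurable
  rw [← hE] at h1
  have h2 : μ[μ[Y | sigmaOf X I] | sigmaOf X J] =ᵐ[μ]
      fun ω => K fun i => X i.1 ω := by
    refine h1.trans (.of_forall fun ω => integral_congr_ae (.of_forall fun c => ?_))
    change h _ = h _
    congr 1
    ext i
    by_cases hi : i.1 ∈ J <;> simp [r, Function.updateFinset, hi]
  have hKm : StronglyMeasurable[sigmaOf X (I ∩ J)] fun ω => K fun i => X i.1 ω :=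
    hK.comp_measurable (comap_measurable _)
  have hKint : Integrable (fun ω => K fun i => X i.1 ω) μ := integrable_condExp.congr h2
  -- Being measurable for `X_(I ∩ J)`, the iterated projection is its own projection there, and the
  -- tower property removes both inner conditionings.
  calc μ[μ[Y | sigmaOf X I] | sigmaOf X J]
      =ᵐ[μ] fun ω => K fun i => X i.1 ω := h2
    _ = μ[fun ω => K fun i => X i.1 ω | sigmaOf X (I ∩ J)] :=
        (condExp_of_stronglyMeasurable (sigmaOf_le hX _) hKm hKint).symm
    _ =ᵐ[μ] μ[μ[μ[Y | sigmaOf X I] | sigmaOf X J] | sigmaOf X (I ∩ J)] :=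
        condExp_congr_ae h2.symm
    _ =ᵐ[μ] μ[μ[Y | sigmaOf X I] | sigmaOf X (I ∩ J)] :=
        condExp_condExp_of_le (sigmaOf_mono X Finset.inter_subset_right) (sigmaOf_le hX _)
    _ =ᵐ[μ] μ[Y | sigmaOf X (I ∩ J)] :=
        condExp_condExp_of_le (sigmaOf_mono X Finset.inter_subset_left) (sigmaOf_le hX _)

/-! ### Orthogonality of the ANOVA components -/

theorem covariance_condExp_sigmaOf {X : Fin p → Ω → ℝ} (hX : ∀ i, Measurable (X i))
    (hXind : iIndepFun X μ) {Y : Ω → ℝ} (hY : MemLp Y 2 μ) (I J : Finset (Fin p)) :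
    cov[μ[Y | sigmaOf X I], μ[Y | sigmaOf X J]; μ] = Var[μ[Y | sigmaOf X (I ∩ J)]; μ] := by
  have hL : ∀ K, MemLp (μ[Y | sigmaOf X K]) 2 μ := fun K => hY.condExp one_le_two
  have hE : ∀ K, ∫ ω, (μ[Y | sigmaOf X K]) ω ∂μ = ∫ ω, Y ω ∂μ := fun K =>
    integral_condExp (sigmaOf_le hX K)
  rw [← covariance_self (hL _).aemeasurable, covariance_eq_sub (hL _) (hL _),
    covariance_eq_sub (hL _) (hL _), hE, hE, hE]
  congr 1
  have step1 : ∫ ω, (μ[Y | sigmaOf X I]) ω * (μ[Y | sigmaOf X J]) ω ∂μ =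
      ∫ ω, (μ[Y | sigmaOf X J]) ω * (μ[Y | sigmaOf X (I ∩ J)]) ω ∂μ := by
    rw [integral_condExp_mul (sigmaOf_le hX J) (hL I) (hL J) stronglyMeasurable_condExp]
    refine integral_congr_ae ?_
    filter_upwards [condExp_condExp_sigmaOf hX hXind Y I J] with ω hω
    rw [hω, mul_comm]
  have step2 : ∫ ω, (μ[Y | sigmaOf X J]) ω * (μ[Y | sigmaOf X (I ∩ J)]) ω ∂μ =
      ∫ ω, (μ[Y | sigmaOf X (I ∩ J)]) ω * (μ[Y | sigmaOf X (I ∩ J)]) ω ∂μ := by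
    rw [integral_condExp_mul (sigmaOf_le hX (I ∩ J)) (hL J) (hL (I ∩ J))
      stronglyMeasurable_condExp]
    refine integral_congr_ae ?_
    filter_upwards [condExp_condExp_of_le (f := Y) (μ := μ)
      (sigmaOf_mono X (Finset.inter_subset_right (s₁ := I) (s₂ := J)))
      (sigmaOf_le hX J)] with ω hω
    rw [hω]
  exact step1.trans step2

theorem covariance_anova_condExp {X : Fin p → Ω → ℝ} (hX : ∀ i, Measurable (X i))
    (hXind : iIndepFun X μ) {Y : Ω → ℝ} (hY : MemLp Y 2 μ) (T J : Finset (Fin p))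
    (hTJ : ¬ T ⊆ J) : cov[anova μ X Y T, μ[Y | sigmaOf X J]; μ] = 0 := by
  induction T using Finset.strongInduction with
  | _ T ih =>
    have h : anova μ X Y T = fun ω =>
        (μ[Y | sigmaOf X T]) ω - ∑ T' ∈ T.ssubsets, anova μ X Y T' ω :=
      funext (anova_eq μ X Y T)
    have hL : ∀ K, MemLp (μ[Y | sigmaOf X K]) 2 μ := fun K => hY.condExp one_le_two
    have hA := memLp_anova X hY
    -- By induction only `T' ⊆ J` contribute. These are automatically proper subsets of `T`, and
    -- they sum to the projection onto `X_(T ∩ J)`, cancelling the leading term.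
    have h1 : ∑ T' ∈ T.ssubsets, cov[anova μ X Y T', μ[Y | sigmaOf X J]; μ] =
        ∑ T' ∈ (T ∩ J).powerset, cov[anova μ X Y T', μ[Y | sigmaOf X J]; μ] := by
      symm
      apply Finset.sum_subset
      · intro R hR
        rw [Finset.mem_powerset, Finset.subset_inter_iff] at hR
        exact Finset.mem_ssubsets.2 ⟨hR.1, fun hT => hTJ (hT.trans hR.2)⟩
      · intro R hR hR'
        rw [Finset.mem_ssubsets] at hR
        exact ih R hR fun hJ => hR' (Finset.mem_powerset.2 (Finset.subset_inter hR.1 hJ))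
    rw [h, covariance_fun_sub_left (hL T) (memLp_finsetSum _ fun T' _ => hA T') (hL J),
      covariance_fun_sum_left' (fun T' _ => hA T') (hL J), h1,
      ← covariance_fun_sum_left' (fun T' _ => hA T') (hL J), ← condExp_eq_sum_anova,
      covariance_condExp_sigmaOf hX hXind hY, covariance_condExp_sigmaOf hX hXind hY,
      Finset.inter_assoc, Finset.inter_self, sub_self]

theorem covariance_anova_anova_of_not_subset {X : Fin p → Ω → ℝ} (hX : ∀ i, Measurable (X i))
    (hXind : iIndepFun X μ) {Y : Ω → ℝ} (hY : MemLp Y 2 μ) (T R : Finset (Fin p))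
    (hTR : ¬ T ⊆ R) : cov[anova μ X Y T, anova μ X Y R; μ] = 0 := by
  induction R using Finset.strongInduction with
  | _ R ih =>
    have h : anova μ X Y R = fun ω =>
        (μ[Y | sigmaOf X R]) ω - ∑ T' ∈ R.ssubsets, anova μ X Y T' ω :=
      funext (anova_eq μ X Y R)
    have hA := memLp_anova X hY
    rw [h, covariance_fun_sub_right (hA T) (hY.condExp one_le_two)
      (memLp_finsetSum _ fun T' _ => hA T'), covariance_fun_sum_right' (fun T' _ => hA T') (hA T),
      covariance_anova_condExp hX hXind hY T R hTR, zero_sub, neg_eq_zero]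
    refine Finset.sum_eq_zero fun Q hQ => ?_
    rw [Finset.mem_ssubsets] at hQ
    exact ih Q hQ fun hT => hTR (hT.trans hQ.1)

theorem covariance_anova_of_ne {X : Fin p → Ω → ℝ} (hX : ∀ i, Measurable (X i))
    (hXind : iIndepFun X μ) {Y : Ω → ℝ} (hY : MemLp Y 2 μ) {T R : Finset (Fin p)}
    (hTR : T ≠ R) : cov[anova μ X Y T, anova μ X Y R; μ] = 0 := by
  by_cases h : T ⊆ R
  · rw [covariance_comm]
    exact covariance_anova_anova_of_not_subset hX hXind hY R T fun h' => hTR (h.antisymm h')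
  · exact covariance_anova_anova_of_not_subset hX hXind hY T R h

/-- The variance decomposition of a function of independent variables. -/
theorem phi_eq_sum_sobol {X : Fin p → Ω → ℝ} (hX : ∀ i, Measurable (X i))
    (hXind : iIndepFun X μ) {Y : Ω → ℝ} (hY : MemLp Y 2 μ) (I : Finset (Fin p)) :
    phi μ X Y I = ∑ T ∈ I.powerset, sobol μ X Y T := by
  have hA := memLp_anova X hY
  simp_rw [phi, sobol]
  rw [← Finset.sum_div]
  congr 1
  rw [condExp_eq_sum_anova, ← covariance_self
    (memLp_finsetSum _ fun T _ => hA T : MemLp _ 2 μ).aemeasurable,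
    covariance_fun_sum_fun_sum' (fun T _ => hA T) (fun T _ => hA T)]
  refine Finset.sum_congr rfl fun T hT => ?_
  rw [Finset.sum_eq_single_of_mem T hT
    fun R _ hR => covariance_anova_of_ne hX hXind hY hR.symm, covariance_self (hA T).aemeasurable]

end CondExp

/-! ### Shapley weights and random orderings -/

section Combinatorics

variable {p : ℕ}

/-- The increment of a set function given by a sum over subsets. -/
theorem ICC_eq_sum {ψ s : Finset (Fin p) → ℝ} (hψ : ∀ I, ψ I = ∑ T ∈ I.powerset, s T)
    {j : Fin p} {I : Finset (Fin p)} (hj : j ∉ I) :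
    ICC ψ j I = ∑ T ∈ Finset.univ.filter (fun T : Finset (Fin p) => j ∈ T),
      if T.erase j ⊆ I then s T else 0 := by
  rw [ICC, hψ, hψ, ← Finset.sum_filter, Finset.filter_filter, sub_eq_iff_eq_add,
    ← Finset.sum_union]
  · refine Finset.sum_congr ?_ fun _ _ => rfl
    ext T
    simp only [Finset.mem_powerset, Finset.mem_union, Finset.mem_filter, Finset.mem_univ,
      true_and, Finset.subset_insert_iff]
    by_cases hT : j ∈ T
    · simp only [hT, true_and]
      exact ⟨Or.inl, fun h => h.elim id fun h => (Finset.erase_subset _ _).trans h⟩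
    · simp [hT]
  · rw [Finset.disjoint_left]
    intro T hT hT'
    simp only [Finset.mem_filter, Finset.mem_univ, true_and, Finset.mem_powerset] at hT hT'
    exact hj (hT' hT.1)

/-- Trinomial revision turns each summand into a multiple of `(a + m).choose a`, and the
hockey-stick identity sums these. In the Shapley formula `n = p - 1`, `a = |T| - 1`, and `m` counts
the elements outside `T`. -/
theorem sum_inv_choose_mul_choose (a n : ℕ) (ha : a ≤ n) :
    ∑ m ∈ Finset.range (n - a + 1),
      ((n - a).choose m : ℝ) * (1 / (((n + 1 : ℕ) : ℝ) * (n.choose (a + m) : ℝ))) =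
      1 / ((a + 1 : ℕ) : ℝ) := by
  have hC : (n.choose a : ℝ) ≠ 0 := by exact_mod_cast (Nat.choose_pos ha).ne'
  have h1 : ∀ m ∈ Finset.range (n - a + 1),
      ((n - a).choose m : ℝ) * (1 / (((n + 1 : ℕ) : ℝ) * (n.choose (a + m) : ℝ))) =
      ((a + m).choose a : ℝ) / (((n + 1 : ℕ) : ℝ) * (n.choose a : ℝ)) := by
    intro m hm
    rw [Finset.mem_range] at hm
    have h : n.choose (a + m) * (a + m).choose a = n.choose a * (n - a).choose m := by
      rw [Nat.choose_mul (Nat.le_add_right a m), Nat.add_sub_cancel_left]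
    have h' : (n.choose (a + m) : ℝ) * ((a + m).choose a : ℝ) =
      (n.choose a : ℝ) * ((n - a).choose m : ℝ) := by exact_mod_cast h
    have hD : (n.choose (a + m) : ℝ) ≠ 0 := by
      exact_mod_cast (Nat.choose_pos (by omega : a + m ≤ n)).ne'
    have hn : ((n + 1 : ℕ) : ℝ) ≠ 0 := by positivity
    field_simp
    linarith
  rw [Finset.sum_congr rfl h1, ← Finset.sum_div]
  have h2 : ∑ m ∈ Finset.range (n - a + 1), (a + m).choose a = (n + 1).choose (a + 1) := by
    simpa only [add_comm _ a, Nat.add_sub_cancel' ha] using Nat.sum_range_add_choose (n - a) a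
  have h3 : (n + 1) * n.choose a = (n + 1).choose (a + 1) * (a + 1) := Nat.add_one_mul_choose_eq n a
  have h3' : ((n + 1 : ℕ) : ℝ) * (n.choose a : ℝ) =
      ((n + 1).choose (a + 1) : ℝ) * ((a + 1 : ℕ) : ℝ) := by exact_mod_cast h3
  have h4 : ((n + 1).choose (a + 1) : ℝ) ≠ 0 := by
    exact_mod_cast (Nat.choose_pos (by omega : a + 1 ≤ n + 1)).ne'
  have ha' : ((a + 1 : ℕ) : ℝ) ≠ 0 := by positivity
  have h2' : ∑ m ∈ Finset.range (n - a + 1), ((a + m).choose a : ℝ) =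
      ((n + 1).choose (a + 1) : ℝ) := by exact_mod_cast h2
  rw [h2', h3']
  field_simp

/-- The Shapley weights of the sets that contain `T \ {j}` add up to `1 / |T|`. -/
theorem sum_shapley_weights {j : Fin p} {T : Finset (Fin p)} (hj : j ∈ T) :
    ∑ I ∈ (Finset.univ.erase j).powerset, (if T.erase j ⊆ I then
      1 / ((p : ℝ) * ((p - 1).choose I.card : ℝ)) else 0) = 1 / (T.card : ℝ) := by
  obtain ⟨n, rfl⟩ : ∃ n, p = n + 1 := ⟨p - 1, by have := j.2; omega⟩
  have hT : 1 ≤ T.card := Finset.card_pos.2 ⟨j, hj⟩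
  have hTn : T.card ≤ n + 1 := by simpa using Finset.card_le_univ T
  have hT' : (T.erase j).card = T.card - 1 := Finset.card_erase_of_mem hj
  rw [← Finset.sum_filter]
  have hbij : ∑ I ∈ (Finset.univ.erase j).powerset with T.erase j ⊆ I,
      1 / (((n + 1 : ℕ) : ℝ) * ((n + 1 - 1).choose I.card : ℝ)) =
      ∑ R ∈ Tᶜ.powerset,
        1 / (((n + 1 : ℕ) : ℝ) * (n.choose ((T.card - 1) + R.card) : ℝ)) := by
    symm
    -- Each admissible `I` is `T.erase j` together with an arbitrary `R ⊆ Tᶜ`.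
    refine Finset.sum_bij' (fun R _ => T.erase j ∪ R) (fun I _ => I \ T.erase j) ?_ ?_ ?_ ?_ ?_
    · intro R hR
      rw [Finset.mem_powerset] at hR
      simp only [Finset.mem_filter, Finset.mem_powerset, Finset.subset_union_left, and_true]
      intro i hi
      rw [Finset.mem_union] at hi
      rcases hi with hi | hi
      · simp [Finset.ne_of_mem_erase hi]
      · have := Finset.mem_compl.1 (hR hi)
        simp only [Finset.mem_erase, Finset.mem_univ, and_true]
        rintro rfl
        exact this hj
    · intro I hI
      simp only [Finset.mem_filter, Finset.mem_powerset] at hI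
      rw [Finset.mem_powerset]
      intro i hi
      rw [Finset.mem_sdiff, Finset.mem_erase] at hi
      have := Finset.ne_of_mem_erase (hI.1 hi.1)
      rw [Finset.mem_compl]
      exact fun h => hi.2 ⟨this, h⟩
    · intro R hR
      rw [Finset.mem_powerset] at hR
      refine Finset.union_sdiff_cancel_left (Finset.disjoint_left.2 fun i hi hi' => ?_)
      exact Finset.mem_compl.1 (hR hi') (Finset.mem_of_mem_erase hi)
    · intro I hI
      simp only [Finset.mem_filter, Finset.mem_powerset] at hI
      exact Finset.union_sdiff_of_subset hI.2
    · intro R hR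
      rw [Finset.mem_powerset] at hR
      rw [Finset.card_union_of_disjoint (Finset.disjoint_left.2 fun i hi hi' =>
        Finset.mem_compl.1 (hR hi') (Finset.mem_of_mem_erase hi)), hT', Nat.add_sub_cancel]
  rw [hbij, Finset.sum_powerset_apply_card
    (fun m => 1 / (((n + 1 : ℕ) : ℝ) * (n.choose ((T.card - 1) + m) : ℝ)))]
  have hc : Tᶜ.card = n - (T.card - 1) := by
    rw [Finset.card_compl, Fintype.card_fin]; omega
  simp_rw [hc, nsmul_eq_mul]
  rw [sum_inv_choose_mul_choose _ _ (by omega), Nat.sub_add_cancel hT]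

theorem ICCSh_eq_sum {ψ s : Finset (Fin p) → ℝ} (hψ : ∀ I, ψ I = ∑ T ∈ I.powerset, s T)
    (j : Fin p) :
    ICCSh ψ j = ∑ T ∈ Finset.univ.filter (fun T : Finset (Fin p) => j ∈ T),
      s T / (T.card : ℝ) := by
  have h1 : ICCSh ψ j = ∑ I ∈ (Finset.univ.erase j).powerset,
      ∑ T ∈ Finset.univ.filter (fun T : Finset (Fin p) => j ∈ T),
        (if T.erase j ⊆ I then 1 / ((p : ℝ) * ((p - 1).choose I.card : ℝ)) else 0) * s T := by
    refine Finset.sum_congr rfl fun I hI => ?_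
    have hj : j ∉ I := fun h => Finset.notMem_erase j _ (Finset.mem_powerset.1 hI h)
    rw [ICC_eq_sum hψ hj, Finset.mul_sum]
    exact Finset.sum_congr rfl fun T _ => by split_ifs <;> simp
  rw [h1, Finset.sum_comm]
  refine Finset.sum_congr rfl fun T hT => ?_
  rw [← Finset.sum_mul, sum_shapley_weights (Finset.mem_filter.1 hT).2]
  ring

/-- Among all orderings, each element of `T` is the last element of `T` equally often. -/
theorem card_mul_card_perm_last {j : Fin p} {T : Finset (Fin p)} (hj : j ∈ T) :
    T.card * (Finset.univ.filter fun π : Equiv.Perm (Fin p) => T.erase j ⊆ before π j).card =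
      Fintype.card (Equiv.Perm (Fin p)) := by
  let L : Fin p → Finset (Equiv.Perm (Fin p)) := fun k =>
    Finset.univ.filter fun π => T.erase k ⊆ before π k
  have hmem : ∀ k π, π ∈ L k ↔ ∀ i ∈ T, i ≠ k → π i < π k := by
    intro k π
    simp only [L, before, Finset.mem_filter, Finset.mem_univ, true_and, Finset.subset_iff,
      Finset.mem_erase]
    exact ⟨fun h i hi hk => h ⟨hk, hi⟩, fun h i hi => h i hi.2 hi.1⟩
  have hcard : ∀ k ∈ T, (L k).card = (L j).card := by
    intro k hk
    -- Exchanging the positions of `a` and `b` makes `b` last in `T` instead of `a`.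
    have hmaps : ∀ a ∈ T, ∀ b ∈ T, ∀ π ∈ L a, π * Equiv.swap a b ∈ L b := by
      intro a ha b hb π hπ
      rw [hmem] at hπ ⊢
      intro i hi hib
      rw [Equiv.Perm.mul_apply, Equiv.Perm.mul_apply, Equiv.swap_apply_right]
      by_cases hia : i = a
      · subst hia
        rw [Equiv.swap_apply_left]
        exact hπ b hb hib.symm
      · rw [Equiv.swap_apply_of_ne_of_ne hia hib]
        exact hπ i hi hia
    refine Finset.card_bij' (fun π _ => π * Equiv.swap k j) (fun π _ => π * Equiv.swap j k)
      (hmaps k hk j hj) (hmaps j hj k hk) ?_ ?_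
    · intro π _
      rw [Equiv.swap_comm j k, mul_assoc, Equiv.swap_mul_self, mul_one]
    · intro π _
      rw [Equiv.swap_comm j k, mul_assoc, Equiv.swap_mul_self, mul_one]
  have hdisj : (T : Set (Fin p)).PairwiseDisjoint L := by
    intro a ha b hb hab
    rw [Function.onFun, Finset.disjoint_left]
    intro π h1 h2
    exact lt_asymm ((hmem a π).1 h1 b hb hab.symm) ((hmem b π).1 h2 a ha hab)
  have hunion : T.biUnion L = Finset.univ := by
    refine Finset.eq_univ_of_forall fun π => ?_
    obtain ⟨k, hk, hmax⟩ := T.exists_max_image π ⟨j, hj⟩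
    exact Finset.mem_biUnion.2 ⟨k, hk, (hmem k π).2 fun i hi hik =>
      lt_of_le_of_ne (hmax i hi) (π.injective.ne hik)⟩
  change T.card * (L j).card = _
  rw [← Finset.card_univ, ← hunion, Finset.card_biUnion hdisj, Finset.sum_congr rfl hcard,
    Finset.sum_const, smul_eq_mul]

theorem ICCTo_eq_sum_of_forall_not_adj {S : SCM p} (hS : ∀ i j, ¬ S.Adj i j)
    {ψ s : Finset (Fin p) → ℝ} (hψ : ∀ I, ψ I = ∑ T ∈ I.powerset, s T) (j : Fin p) :
    ICCTo S ψ j = ∑ T ∈ Finset.univ.filter (fun T : Finset (Fin p) => j ∈ T),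
      s T / (T.card : ℝ) := by
  have htop : S.topologicalOrderings = Finset.univ := by
    refine Finset.eq_univ_of_forall fun π => ?_
    simp [SCM.topologicalOrderings, hS]
  have hj : ∀ π : Equiv.Perm (Fin p), j ∉ before π j := fun π => by simp [before]
  rw [ICCTo, htop, Finset.sum_congr rfl fun π _ => ICC_eq_sum hψ (hj π), Finset.sum_comm,
    Finset.mul_sum]
  refine Finset.sum_congr rfl fun T hT => ?_
  have hjT := (Finset.mem_filter.1 hT).2
  rw [← Finset.sum_filter, Finset.sum_const, nsmul_eq_mul, Finset.card_univ]
  have h : (T.card : ℝ) * ((Finset.univ.filter fun π : Equiv.Perm (Fin p) =>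
      T.erase j ⊆ before π j).card : ℝ) = (Fintype.card (Equiv.Perm (Fin p)) : ℝ) := by
    exact_mod_cast card_mul_card_perm_last hjT
  have hT0 : (T.card : ℝ) ≠ 0 := by exact_mod_cast (Finset.card_pos.2 ⟨j, hjT⟩).ne'
  have hP : (Fintype.card (Equiv.Perm (Fin p)) : ℝ) ≠ 0 := by
    exact_mod_cast Fintype.card_ne_zero
  -- Written as a product, the nonzero number of orderings shows that the count to be cancelled is
  -- nonzero.
  rw [← h] at hP ⊢
  have hc := right_ne_zero_of_mul hP
  field_simp

end Combinatorics

theorem mainTheorem1 {Ω : Type*} [MeasurableSpace Ω] (μ : Measure Ω) [IsProbabilityMeasure μ]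
    {p : ℕ} (S : SCM p) (hmono : S.IsMonotone)
    (U : Fin p → Ω → ℝ) (hU : ∀ i, Measurable (U i)) (hUindep : iIndepFun U μ)
    (hXindep : iIndepFun (S.X U) μ)
    (N : (Fin p → ℝ) → ℝ) (hN : Measurable N)
    (Y : Ω → ℝ) (hY : Y = fun ω => N (fun j => S.X U j ω))
    (hY2 : MemLp Y 2 μ) (hVar : 0 < Var[Y; μ]) :
    (∀ I : Finset (Fin p),
      phi μ U Y I = phi μ (S.X U) Y I ∧
      phi μ (S.X U) Y I = ∑ T ∈ I.powerset, sobol μ (S.X U) Y T) ∧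
    (∀ j : Fin p,
      ICCSh (phi μ U Y) j =
        ∑ T ∈ Finset.univ.filter (fun T : Finset (Fin p) => j ∈ T),
          sobol μ (S.X U) Y T / (T.card : ℝ)) ∧
    (S.IsMinimal μ U → ∀ j : Fin p,
      ICCTo S (phi μ U Y) j = ICCSh (phi μ U Y) j ∧
      ICCTo S (phi μ U Y) j =
        ∑ T ∈ Finset.univ.filter (fun T : Finset (Fin p) => j ∈ T),
          sobol μ (S.X U) Y T / (T.card : ℝ)) := by
  have hX := S.measurable_X hU
  have hfun := S.exists_X_ae_eq_comp hmono hU hUindep hXindep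
  choose g hg hXg using hfun
  have hU_X : ∀ I, phi μ U Y I = phi μ (S.X U) Y I := by
    intro I
    have h := condExp_sigmaOf_ae_eq_of_ae_eq_comp hU hX hUindep hXindep hg hXg hN
      (hY ▸ hY2.integrable one_le_two) I
    rw [phi, phi, hY, variance_congr h]
  have hsum := phi_eq_sum_sobol hX hXindep hY2
  have hψ : ∀ I, phi μ U Y I = ∑ T ∈ I.powerset, sobol μ (S.X U) Y T := fun I =>
    (hU_X I).trans (hsum I)
  refine ⟨fun I => ⟨hU_X I, hsum I⟩, ICCSh_eq_sum hψ, fun hmin j => ?_⟩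
  have hTo := ICCTo_eq_sum_of_forall_not_adj
    (hmin.not_adj fun j => ⟨g j, hg j, hXg j⟩) hψ j
  exact ⟨hTo.trans (ICCSh_eq_sum hψ j).symm, hTo⟩
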